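/- Let $M$ be a smooth $n$-dimensional manifold with tangent bundle $\pi\colon TM\to M$. For a smooth function $h$ on $M$ let $\dot h\colon TM\to\mathbb R$, $\dot h(u)=u\langle h\rangle$, be its scalar lift. Let $U\subset TM\setminus\{0\}$ be a conic sub-bundle, that is, an embedded smooth submanifold of $TM$ (without boundary, of any dimension) that contains no zero vector and satisfies $\pi(U)=M$ and $\lambda u\in U$ for all $u\in U$ and $\lambda\neq0$. Let $\mathcal R$ be the radial vector field on $U$, whose value at $u$ is the velocity at $t=0$ of the curve $t\mapsto e^{t}u$; equivalently, $\mathcal R\langle\pi^*h\rangle=0$ and $\mathcal R\langle\dot h\rangle=\dot h$ for all smooth $h$ on $M$. A Vlasov field on $U$ is a smooth vector field $W$ on $U$ such that, for every smooth function $h$ on $M$, one has $W\langle\pi^*h\rangle=\dot h$ on $U$, and $W\langle\dot h\rangle|_{\lambda u}=\lambda^2\,W\langle\dot h\rangle|_{u}$ for all $u\in U$ and $\lambda>0$. A bivector $\Phi$ on $U$ is simple if $\Phi=X\wedge Y$ with smooth vector fields $X,Y$; it is horizontal if it is simple, $\mathcal R\wedge\Phi=0$, and $\Phi\langle\pi^*f,\dot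 h\rangle=-\dot f\,\dot h$ for all smooth functions $f,h$ on $M$, where $(X\wedge Y)\langle F,G\rangle=X\langle F\rangle Y\langle G\rangle-X\langle G\rangle Y\langle F\rangle$. A Vlasov bivector on $U$ is a horizontal bivector $\Psi$ for which there is a Vlasov field $W$ on $U$ with $\Psi=\mathcal R\wedge W$. Theorem. Let $\Psi$ be a Vlasov bivector on $U$. Then for every $u\in U$ there is a $2$-dimensional embedded smooth submanifold $K\subset U$ with $u\in K$ such that $\Psi$ is tangent to $K$: for every representation $\Psi=X\wedge Y$ with smooth vector fields $X,Y$ on $U$, both $X$ and $Y$ are tangent to $K$, i.e. each of them is induced on $K$ by a smooth vector field on $K$. -/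

import Mathlib

open Set Manifold
open scoped Manifold ContDiff Topology

noncomputable section

namespace Vlasov

/-! ### Scalar fields, vector fields and bivectors on a manifold -/

section General

variable {E : Type*} [NormedAddCommGroup E] [NormedSpace ℝ E]
  {H : Type*} [TopologicalSpace H] (I : ModelWithCorners ℝ E H)
  {N : Type*} [TopologicalSpace N] [ChartedSpace H N]

/-- `h` is a smooth real-valued function on `N`. -/
def IsScalarField (h : N → ℝ) : Prop :=
  ContMDiff I 𝓘(ℝ, ℝ) ∞ h

/-- The section `X` of the tangent bundle of `N` is smooth. -/
def IsVectorField [IsManifold I ∞ N] (X : (p : N) → TangentSpace I p) : Prop :=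
  ContMDiff I I.tangent ∞ (fun p => (⟨p, X p⟩ : TangentBundle I N))

/-- The differential `dF` at `p`, as a linear form on the tangent space at `p`. -/
def differential (F : N → ℝ) (p : N) : Module.Dual ℝ (TangentSpace I p) :=
  (mfderiv I 𝓘(ℝ, ℝ) F p).toLinearMap

/-- The action `X⟨F⟩` of a vector field on a scalar field. -/
def act (X : (p : N) → TangentSpace I p) (F : N → ℝ) (p : N) : ℝ :=
  differential I F p (X p)

/-- The scalar lift `ḣ : TN → ℝ`, `ḣ(u) = u⟨h⟩`. -/
def scalarLift (h : N → ℝ) (u : TangentBundle I N) : ℝ :=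
  differential I h u.proj u.snd

/-- The value at each point of the exterior product `X ∧ Y`. -/
def wedge (X Y : (p : N) → TangentSpace I p) (p : N) : ⋀[ℝ]^2 (TangentSpace I p) :=
  exteriorPower.ιMulti ℝ 2 ![X p, Y p]

/-- `X, Y` are smooth vector fields with `Φ = X ∧ Y`. -/
def IsRepresentation [IsManifold I ∞ N] (Φ : (p : N) → ⋀[ℝ]^2 (TangentSpace I p))
    (X Y : (p : N) → TangentSpace I p) : Prop :=
  IsVectorField I X ∧ IsVectorField I Y ∧ Φ = wedge I X Y

/-- A simple bivector: `Φ = X ∧ Y` for some smooth vector fields. -/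
def IsSimpleBivector [IsManifold I ∞ N] (Φ : (p : N) → ⋀[ℝ]^2 (TangentSpace I p)) : Prop :=
  ∃ X Y : (p : N) → TangentSpace I p, IsRepresentation I Φ X Y

/-- The pairing `Φ⟨F, G⟩` of a bivector with two scalar fields, `(dF ∧ dG)(Φ)`. -/
def pairing (Φ : (p : N) → ⋀[ℝ]^2 (TangentSpace I p)) (F G : N → ℝ) (p : N) : ℝ :=
  exteriorPower.pairingDual ℝ (TangentSpace I p) 2
    (exteriorPower.ιMulti ℝ 2 ![differential I F p, differential I G p]) (Φ p)

theorem pairing_wedge (X Y : (p : N) → TangentSpace I p) (F G : N → ℝ) (p : N) :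
    pairing I (wedge I X Y) F G p =
      act I X F p * act I Y G p - act I X G p * act I Y F p := by
  simp [pairing, wedge, act, exteriorPower.pairingDual_ιMulti_ιMulti, Matrix.det_fin_two]

variable {E' : Type*} [NormedAddCommGroup E'] [NormedSpace ℝ E']
  {H' : Type*} [TopologicalSpace H'] (J : ModelWithCorners ℝ E' H')
  {K : Type*} [TopologicalSpace K] [ChartedSpace H' K] [IsManifold J ∞ K]

/-- The vector field `X` on `N` is tangent to the submanifold `Θ : K → N`: it is induced by a smooth
vector field `Y` on `K`. -/
def IsTangentField (Θ : K → N) (X : (p : N) → TangentSpace I p) : Prop :=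
  ∃ Y : (q : K) → TangentSpace J q, IsVectorField J Y ∧
    ∀ q : K, mfderiv J I Θ q (Y q) = X (Θ q)

/-- The simple bivector `Φ` on `N` is tangent to the submanifold `Θ : K → N`: both factors of every
representation `Φ = X ∧ Y` are tangent to it. -/
def IsTangentBivector [IsManifold I ∞ N] (Θ : K → N)
    (Φ : (p : N) → ⋀[ℝ]^2 (TangentSpace I p)) : Prop :=
  IsSimpleBivector I Φ ∧
    ∀ X Y : (p : N) → TangentSpace I p, IsRepresentation I Φ X Y →
      IsTangentField I J Θ X ∧ IsTangentField I J Θ Y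

end General

/-! ### Conic sub-bundles of the slit tangent bundle -/

section Conic

variable {n : ℕ} {M : Type*} [TopologicalSpace M] [ChartedSpace (EuclideanSpace ℝ (Fin n)) M]

/-- Multiplication by a scalar in the fibres of the tangent bundle. -/
def dilate (c : ℝ) (u : TangentBundle (𝓡 n) M) : TangentBundle (𝓡 n) M :=
  ⟨u.proj, c • u.snd⟩

/-- `U` avoids the zero vectors, is invariant under multiplication by every `c ≠ 0`, and projects
onto `M`. -/
structure IsConic (U : Set (TangentBundle (𝓡 n) M)) : Prop where
  snd_ne_zero : ∀ u ∈ U, u.snd ≠ 0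
  proj_surjective : ∀ p : M, ∃ u ∈ U, u.proj = p
  dilate_mem : ∀ u ∈ U, ∀ c : ℝ, c ≠ 0 → dilate c u ∈ U

variable [IsManifold (𝓡 n) ∞ M]

/-- A conic sub-bundle: a conic subset of the tangent bundle that is an embedded smooth submanifold
without boundary, of some dimension `d` (`d = 2 n` when `U` is open; `d = 2 n - 1` for the light
cone). Local triviality of `U → M` is not required, so that the class is wider than that of the
conic subsets that are smooth fibre bundles. -/
structure IsConicSubbundle {d : ℕ} (U : Set (TangentBundle (𝓡 n) M))
    [ChartedSpace (EuclideanSpace ℝ (Fin d)) U] [IsManifold (𝓡 d) ∞ U] : Prop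
    extends IsConic U where
  isSmoothEmbedding : IsSmoothEmbedding (𝓡 d) (𝓡 n).tangent ∞
    (Subtype.val : U → TangentBundle (𝓡 n) M)

variable {U : Set (TangentBundle (𝓡 n) M)}

/-- Multiplication by `c ≠ 0` as a map of `U` to itself. -/
def IsConic.dilate (hU : IsConic U) (c : ℝ) (hc : c ≠ 0) (u : U) : U :=
  ⟨Vlasov.dilate c u, hU.dilate_mem u u.2 c hc⟩

/-- The function `π^* h` on `U`. -/
def pull (U : Set (TangentBundle (𝓡 n) M)) (h : M → ℝ) (u : U) : ℝ :=
  h (u : TangentBundle (𝓡 n) M).proj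

/-- The restriction to `U` of the scalar lift of `h`. -/
def lift (U : Set (TangentBundle (𝓡 n) M)) (h : M → ℝ) (u : U) : ℝ :=
  scalarLift (𝓡 n) h u

variable {d : ℕ} [ChartedSpace (EuclideanSpace ℝ (Fin d)) U]

/-- The radial vector field on `U`: its value at `u` is the velocity at `t = 0` of the curve
`t ↦ e ^ t u` in `U`. -/
def IsConic.radial (hU : IsConic U) (u : U) : TangentSpace (𝓡 d) u :=
  mfderiv 𝓘(ℝ, ℝ) (𝓡 d) (fun t : ℝ => hU.dilate (Real.exp t) (Real.exp_ne_zero t) u) 0 (1 : ℝ)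

variable [IsManifold (𝓡 d) ∞ U]

/-- A Vlasov field on `U`: a smooth vector field that is horizontal and radially quadratic. -/
structure IsVlasovField (hU : IsConic U) (W : (u : U) → TangentSpace (𝓡 d) u) : Prop where
  isVectorField : IsVectorField (𝓡 d) W
  horizontal : ∀ h : M → ℝ, IsScalarField (𝓡 n) h → ∀ u : U,
    act (𝓡 d) W (pull U h) u = lift U h u
  quadratic : ∀ h : M → ℝ, IsScalarField (𝓡 n) h → ∀ (u : U) (c : ℝ) (hc : 0 < c),
    act (𝓡 d) W (lift U h) (hU.dilate c hc.ne' u) = c ^ 2 * act (𝓡 d) W (lift U h) u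

/-- A horizontal bivector on `U`: a simple bivector with `R ∧ Φ = 0` and
`Φ⟨π^* f, ḣ⟩ = - ḟ ḣ` for all scalar fields `f`, `h` on `M`. -/
structure IsHorizontalBivector (hU : IsConic U)
    (Φ : (u : U) → ⋀[ℝ]^2 (TangentSpace (𝓡 d) u)) : Prop where
  simple : IsSimpleBivector (𝓡 d) Φ
  radial : ∀ u : U, ExteriorAlgebra.ι ℝ (hU.radial u : TangentSpace (𝓡 d) u) *
    (Φ u : ExteriorAlgebra ℝ (TangentSpace (𝓡 d) u)) = 0
  horizontal : ∀ f h : M → ℝ, IsScalarField (𝓡 n) f → IsScalarField (𝓡 n) h → ∀ u : U,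
    pairing (𝓡 d) Φ (pull U f) (lift U h) u = - (lift U f u * lift U h u)

/-- A Vlasov bivector on `U`: a horizontal bivector `Ψ` with `Ψ = R ∧ W` for some Vlasov field
`W`. -/
def IsVlasovBivector (hU : IsConic U)
    (Ψ : (u : U) → ⋀[ℝ]^2 (TangentSpace (𝓡 d) u)) : Prop :=
  IsHorizontalBivector hU Ψ ∧
    ∃ W : (u : U) → TangentSpace (𝓡 d) u, IsVlasovField hU W ∧ Ψ = wedge (𝓡 d) hU.radial W

end Conic

end Vlasov

end

/-!
Dilation by `e ^ s` rescales a Vlasov field: the differential of `u ↦ e ^ s u` sends `W` at `u` to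
`e ^ (-s) W` at `e ^ s u`. Both vectors act in the same way on the functions `π^* h` and `ḣ`, by
horizontality and by the quadratic homogeneity of `W⟨ḣ⟩`, and these functions separate tangent
vectors. Consequently the surface swept out by dilating an integral curve of `W` through `u` is an
integral surface of the distribution spanned by the radial field `R` and `W`, without any appeal to
the Frobenius theorem. As `R` and `W` are linearly independent, `X ∧ Y = R ∧ W` forces `X` and `Y`
into this distribution.
-/

namespace Vlasov

section Immersion

variable {𝕜 : Type*} [RCLike 𝕜] {E : Type*} [NormedAddCommGroup E] [NormedSpace 𝕜 E]
  {F : Type*} [NormedAddCommGroup F] [NormedSpace 𝕜 F] {n : WithTop ℕ∞}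

theorem exists_openPartialHomeomorph_contDiffOn_symm [CompleteSpace E] {f : E → F} {s : Set E}
    (hs : IsOpen s) (hf : ContDiffOn 𝕜 n f s) (hn : n ≠ 0) {x : E} (hx : x ∈ s) {f' : E ≃L[𝕜] F}
    (hf' : HasFDerivAt f (f' : E →L[𝕜] F) x) :
    ∃ e : OpenPartialHomeomorph E F, ⇑e = f ∧ x ∈ e.source ∧ e.source ⊆ s ∧
      ContDiffOn 𝕜 n e.symm e.target := by
  have hfx : ContDiffAt 𝕜 n f x := hf.contDiffAt (hs.mem_nhds hx)
  have h_inv : IsOpen (s ∩ fderiv 𝕜 f ⁻¹' range ((↑) : (E ≃L[𝕜] F) → E →L[𝕜] F)) :=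
    (hf.continuousOn_fderiv_of_isOpen hs
      (ENat.one_le_iff_ne_zero_withTop.2 hn)).isOpen_inter_preimage hs ContinuousLinearEquiv.isOpen
  let e := (hfx.toOpenPartialHomeomorph f hf' hn).restrOpen _ h_inv
  refine ⟨e, rfl, ⟨hfx.mem_toOpenPartialHomeomorph_source hf' hn, hx, f', hf'.fderiv.symm⟩,
    fun y hy => hy.2.1, fun z hz => ?_⟩
  obtain ⟨hzs, g, hg⟩ := (e.map_target hz).2
  have hfz : ContDiffAt 𝕜 n f (e.symm z) := hf.contDiffAt (hs.mem_nhds hzs)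
  refine (e.contDiffAt_symm (f₀' := g) hz ?_ hfz).contDiffWithinAt
  rw [hg]
  exact (hfz.differentiableAt hn).hasFDerivAt

theorem exists_openPartialHomeomorph_straightening [CompleteSpace F] {f : E → F} {s : Set E}
    (hs : IsOpen s) (hf : ContDiffOn 𝕜 n f s) (hn : n ≠ 0) {x : E} (hx : x ∈ s)
    (hf' : (fderiv 𝕜 f x).HasLeftInverse) :
    ∃ (C : Submodule 𝕜 F) (A : (E × C) ≃L[𝕜] F) (χ : OpenPartialHomeomorph F F),
      ContDiffOn 𝕜 n χ χ.source ∧ ContDiffOn 𝕜 n χ.symm χ.target ∧ f x ∈ χ.source ∧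
      ∀ᶠ y in 𝓝 x, χ (f y) = A (y, 0) := by
  obtain ⟨g, hg⟩ := hf'
  let A := (ContinuousLinearEquiv.equivOfRightInverse g (fderiv 𝕜 f x) hg).symm
  have : CompleteSpace (E × g.ker) :=
    (completeSpace_congr (e := A.toEquiv) A.isUniformEmbedding).2 inferInstance
  -- Adding the complementary coordinate to `f` makes its differential invertible.
  let G : E × g.ker → F := fun y => f y.1 + y.2
  have hGs : ContDiffOn 𝕜 n G (s ×ˢ univ) :=
    (hf.comp contDiffOn_fst fun y hy => hy.1).add
      (g.ker.subtypeL.contDiff.comp contDiff_snd).contDiffOn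
  have hG' : HasFDerivAt G (A : (E × g.ker) →L[𝕜] F) (x, 0) := by
    have hfx : HasFDerivAt f (fderiv 𝕜 f x) x :=
      ((hf.contDiffAt (hs.mem_nhds hx)).differentiableAt hn).hasFDerivAt
    exact ((hfx.comp (x, (0 : g.ker)) hasFDerivAt_fst).add
      (g.ker.subtypeL.hasFDerivAt.comp (x, (0 : g.ker)) hasFDerivAt_snd)).congr_fderiv
        (by ext <;> simp [A])
  obtain ⟨e, heG, hxe, hes, he_symm⟩ := exists_openPartialHomeomorph_contDiffOn_symm
    (hs.prod isOpen_univ) hGs hn ⟨hx, mem_univ _⟩ hG'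
  have he_inl (y : E) : e (y, 0) = f y := by simp [heG, G]
  refine ⟨g.ker, A, e.symm.trans A.toHomeomorph.toOpenPartialHomeomorph, ?_, ?_, ?_, ?_⟩
  · exact A.contDiff.comp_contDiffOn (he_symm.mono (by simp))
  · exact (heG ▸ hGs.mono hes : ContDiffOn 𝕜 n e e.source).comp A.symm.contDiff.contDiffOn
      fun z hz => by simpa using hz
  · simpa [he_inl] using e.map_source hxe
  · have hcont : Continuous fun y : E => (y, (0 : g.ker)) := by fun_prop
    filter_upwards [hcont.continuousAt.eventually (e.open_source.mem_nhds hxe)] with y hy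
    have := e.left_inv hy
    rw [he_inl] at this
    simp [this]

section Manifold

variable {P : Type*} [TopologicalSpace P] [ChartedSpace E P] [IsManifold 𝓘(𝕜, E) n P]
  {N : Type*} [TopologicalSpace N] [ChartedSpace F N] [IsManifold 𝓘(𝕜, F) n N] {f : P → N} {x : P}

theorem isImmersionAt_of_eventually_writtenInCharts_eq {G : Type*} [NormedAddCommGroup G]
    [NormedSpace 𝕜 G] (hf : ContinuousAt f x) (A : (E × G) ≃L[𝕜] F) {χ : OpenPartialHomeomorph F F}
    (hχ : ContDiffOn 𝕜 n χ χ.source) (hχ_symm : ContDiffOn 𝕜 n χ.symm χ.target)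
    (hfχ : chartAt F (f x) (f x) ∈ χ.source)
    (hχf : ∀ᶠ y in 𝓝 (chartAt E x x),
      χ (chartAt F (f x) (f ((chartAt E x).symm y))) = A (y, 0)) :
    IsImmersionAt 𝓘(𝕜, E) 𝓘(𝕜, F) n f x := by
  let φ := chartAt E x
  let ψ := chartAt F (f x)
  have hφ : φ ∈ IsManifold.maximalAtlas 𝓘(𝕜, E) n P := IsManifold.chart_mem_maximalAtlas x
  have hψ : ψ ∈ IsManifold.maximalAtlas 𝓘(𝕜, F) n N := IsManifold.chart_mem_maximalAtlas (f x)
  have hxφ : x ∈ φ.source := mem_chart_source E x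
  obtain ⟨c, hcf, hc, hxc⟩ := mem_nhds_iff.1 ((φ.continuousAt hxφ).eventually hχf)
  refine IsImmersionAt.mk_of_continuousAt hf A (φ.restr c) (ψ.trans χ) ?_ ?_ ?_ ?_ ?_
  · simpa [hc.interior_eq] using ⟨hxφ, hxc⟩
  · simpa [ψ] using hfχ
  · exact restr_mem_maximalAtlas _ hφ hc
  · refine OpenPartialHomeomorph.mem_maximalAtlas_of_contMDiffOn _ ?_ ?_
    · exact hχ.contMDiffOn.comp ((contMDiffOn_of_mem_maximalAtlas hψ).mono inter_subset_left)
        fun y hy => hy.2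
    · exact (contMDiffOn_symm_of_mem_maximalAtlas hψ).comp
        (hχ_symm.contMDiffOn.mono fun y hy => by simpa using hy.1)
        fun y hy => by simpa using hy.2
  · intro z hz
    obtain ⟨hzφ, hzc⟩ : z ∈ φ.target ∧ φ.symm z ∈ c := by simpa [hc.interior_eq] using hz
    simpa [φ, ψ, φ.right_inv hzφ] using hcf hzc

theorem isImmersionAt_of_hasLeftInverse_mfderiv [CompleteSpace F] {s : Set P} (hs : IsOpen s)
    (hf : ContMDiffOn 𝓘(𝕜, E) 𝓘(𝕜, F) n f s) (hn : n ≠ 0) (hx : x ∈ s)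
    (hf' : (mfderiv 𝓘(𝕜, E) 𝓘(𝕜, F) f x).HasLeftInverse) :
    IsImmersionAt 𝓘(𝕜, E) 𝓘(𝕜, F) n f x := by
  let φ := chartAt E x
  let ψ := chartAt F (f x)
  have hs' : IsOpen (s ∩ f ⁻¹' ψ.source) := hf.continuousOn.isOpen_inter_preimage hs ψ.open_source
  let g : E → F := ψ ∘ f ∘ φ.symm
  let t : Set E := φ.target ∩ φ.symm ⁻¹' (s ∩ f ⁻¹' ψ.source)
  have ht : IsOpen t := φ.isOpen_inter_preimage_symm hs'
  have hg : ContDiffOn 𝕜 n g t := by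
    rw [← contMDiffOn_iff_contDiffOn]
    exact (contMDiffOn_of_mem_maximalAtlas (IsManifold.chart_mem_maximalAtlas (f x))).comp
      (hf.comp ((contMDiffOn_symm_of_mem_maximalAtlas
        (IsManifold.chart_mem_maximalAtlas x)).mono inter_subset_left) fun y hy => hy.2.1)
      fun y hy => hy.2.2
  have hxt : φ x ∈ t := ⟨φ.map_source (mem_chart_source E x), by simp [φ, ψ, hx]⟩
  have hg' : (fderiv 𝕜 g (φ x)).HasLeftInverse := by
    have hfx : MDifferentiableAt 𝓘(𝕜, E) 𝓘(𝕜, F) f x :=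
      (hf.contMDiffAt (hs.mem_nhds hx)).mdifferentiableAt hn
    have : mfderiv 𝓘(𝕜, E) 𝓘(𝕜, F) f x = fderiv 𝕜 g (φ x) := by
      simp only [hfx.mfderiv, writtenInExtChartAt, mfld_simps, fderivWithin_univ]
      rfl
    exact this ▸ hf'
  obtain ⟨C, A, χ, hχ, hχ_symm, hgχ, hχg⟩ :=
    exists_openPartialHomeomorph_straightening ht hg hn hxt hg'
  exact isImmersionAt_of_eventually_writtenInCharts_eq
    (hf.continuousOn.continuousAt (hs.mem_nhds hx)) A hχ hχ_symm (by simpa [g, φ, ψ] using hgχ) hχg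

end Manifold

end Immersion

section Immersion

variable {𝕜 : Type*} [NontriviallyNormedField 𝕜]
  {E : Type*} [NormedAddCommGroup E] [NormedSpace 𝕜 E]
  {H : Type*} [TopologicalSpace H] {I : ModelWithCorners 𝕜 E H}
  {P : Type*} [TopologicalSpace P] [ChartedSpace H P]
  {E' : Type*} [NormedAddCommGroup E'] [NormedSpace 𝕜 E']
  {H' : Type*} [TopologicalSpace H'] {J : ModelWithCorners 𝕜 E' H'}
  {N : Type*} [TopologicalSpace N] [ChartedSpace H' N]
  {n : WithTop ℕ∞} {f : P → N} {x : P}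

theorem exists_contMDiffOn_comp_eqOn_extend_domChart (hf : IsImmersionAt I J n f x) :
    ∃ ρ : N → E, ContMDiffOn J 𝓘(𝕜, E) n ρ hf.codChart.source ∧
      EqOn (ρ ∘ f) (hf.domChart.extend I) hf.domChart.source := by
  refine ⟨fun q => (hf.equiv.symm (hf.codChart.extend J q)).1,
    (contDiff_fst.comp hf.equiv.symm.contDiff).contMDiff.comp_contMDiffOn
      (OpenPartialHomeomorph.contMDiffOn_extend hf.codChart_mem_maximalAtlas), fun y hy => ?_⟩
  have hy' : y ∈ (hf.domChart.extend I).source := by rwa [hf.domChart.extend_source]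
  have h_written := hf.writtenInCharts ((hf.domChart.extend I).map_source hy')
  rw [Function.comp_apply, Function.comp_apply, (hf.domChart.extend I).left_inv hy'] at h_written
  rw [Function.comp_apply, h_written]
  simp

theorem exists_contMDiffOn_leftInverse_of_isImmersionAt [I.Boundaryless]
    (hf : IsImmersionAt I J n f x) :
    ∃ (r : N → P) (v : Set N), IsOpen v ∧ f x ∈ v ∧ ContMDiffOn J I n r v ∧
      ∀ᶠ y in 𝓝 x, r (f y) = y := by
  let φ := hf.domChart
  obtain ⟨ρ, hρ, hρf⟩ := exists_contMDiffOn_comp_eqOn_extend_domChart hf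
  have hρφ : ∀ y ∈ φ.source, ρ (f y) ∈ (φ.extend I).target ∧ (φ.extend I).symm (ρ (f y)) = y := by
    intro y hy
    rw [← φ.extend_source (I := I)] at hy
    rw [← Function.comp_apply (f := ρ), hρf (by simpa using hy)]
    exact ⟨(φ.extend I).map_source hy, (φ.extend I).left_inv hy⟩
  refine ⟨(φ.extend I).symm ∘ ρ, hf.codChart.source ∩ ρ ⁻¹' (φ.extend I).target,
    hρ.continuousOn.isOpen_inter_preimage hf.codChart.open_source φ.isOpen_extend_target,
    ⟨hf.mem_codChart_source, (hρφ x hf.mem_domChart_source).1⟩, ?_, ?_⟩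
  · have hφ_symm : ContMDiffOn 𝓘(𝕜, E) I n (φ.extend I).symm (φ.extend I).target :=
      (contMDiffOn_extend_symm hf.domChart_mem_maximalAtlas).mono
        (by rw [φ.extend_target, I.image_eq])
    exact hφ_symm.comp (hρ.mono inter_subset_left) fun q hq => hq.2
  · filter_upwards [φ.open_source.mem_nhds hf.mem_domChart_source] with y hy
    exact (hρφ y hy).2

theorem mfderiv_apply_mfderiv_of_eventually_leftInverse {r : N → P}
    (hr : MDifferentiableAt J I r (f x)) (hf : MDifferentiableAt I J f x)
    (hrf : ∀ᶠ y in 𝓝 x, r (f y) = y) (v : TangentSpace I x) :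
    mfderiv J I r (f x) (mfderiv I J f x v) = v := by
  have h_id : mfderiv I I (r ∘ f) x = ContinuousLinearMap.id 𝕜 (TangentSpace I x) :=
    ((hasMFDerivAt_id x).congr_of_eventuallyEq hrf).mfderiv
  exact (DFunLike.congr_fun ((mfderiv_comp x hr hf).symm.trans h_id) v :)

theorem hasLeftInverse_mfderiv_of_isImmersionAt [I.Boundaryless] (hn : n ≠ 0)
    (hf : IsImmersionAt I J n f x) :
    (mfderiv I J f x).HasLeftInverse := by
  obtain ⟨r, v, hv, hxv, hr, hrf⟩ := exists_contMDiffOn_leftInverse_of_isImmersionAt hf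
  exact ⟨(mfderiv J I r (f x) : E' →L[𝕜] E), mfderiv_apply_mfderiv_of_eventually_leftInverse
    ((hr.contMDiffAt (hv.mem_nhds hxv)).mdifferentiableAt hn)
    (hf.contMDiffAt.mdifferentiableAt hn) hrf⟩

end Immersion

section Tangent

variable {E : Type*} [NormedAddCommGroup E] [NormedSpace ℝ E]
  {H : Type*} [TopologicalSpace H] {I : ModelWithCorners ℝ E H}
  {N : Type*} [TopologicalSpace N] [ChartedSpace H N] [IsManifold I ∞ N]
  {E' : Type*} [NormedAddCommGroup E'] [NormedSpace ℝ E']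
  {H' : Type*} [TopologicalSpace H'] {J : ModelWithCorners ℝ E' H'} [J.Boundaryless]
  {K : Type*} [TopologicalSpace K] [ChartedSpace H' K] [IsManifold J ∞ K]

theorem isTangentField_of_mem_range_mfderiv {Θ : K → N} (hΘ : ∀ q, IsImmersionAt J I ∞ Θ q)
    {X : (p : N) → TangentSpace I p} (hX : IsVectorField I X)
    (hXΘ : ∀ q, X (Θ q) ∈ (mfderiv J I Θ q).range) : IsTangentField I J Θ X := by
  choose Y hY using fun q => LinearMap.mem_range.1 (hXΘ q)
  simp only [ContinuousLinearMap.coe_coe] at hY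
  refine ⟨Y, fun q => ?_, hY⟩
  obtain ⟨r, v, hv, hqv, hr, hrΘ⟩ := exists_contMDiffOn_leftInverse_of_isImmersionAt (hΘ q)
  have hΘ_smooth : ContMDiffAt J I ∞ Θ q := (hΘ q).contMDiffAt
  have hT : ContMDiffAt J J.tangent ∞
      (fun q' => tangentMapWithin I J r v ⟨Θ q', X (Θ q')⟩) q :=
    ((hr.contMDiffOn_tangentMapWithin (by simp) hv.uniqueMDiffOn).contMDiffAt
      ((FiberBundle.continuous_proj E (TangentSpace I)).isOpen_preimage v hv
        |>.mem_nhds hqv)).comp q (hX.contMDiffAt.comp q hΘ_smooth)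
  refine hT.congr_of_eventuallyEq ?_
  filter_upwards [hrΘ.eventually_nhds, hΘ_smooth.continuousAt.eventually (hv.mem_nhds hqv)]
    with q' hrΘ' hq'v
  have hrX := mfderiv_apply_mfderiv_of_eventually_leftInverse
    ((hr.contMDiffAt (hv.mem_nhds hq'v)).mdifferentiableAt (by simp))
    ((hΘ q').contMDiffAt.mdifferentiableAt (by simp)) hrΘ' (Y q')
  rw [hY q'] at hrX
  have hYX : (Y q' : E') = mfderivWithin I J r v (Θ q') (X (Θ q')) := by
    rw [mfderivWithin_of_isOpen hv hq'v]
    exact hrX.symm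
  exact Bundle.TotalSpace.ext hrΘ'.self_of_nhds.symm (heq_of_eq hYX)

end Tangent

theorem exists_openPartialHomeomorph_image {X Y : Type*} [TopologicalSpace X] [TopologicalSpace Y]
    {f : X → Y} {s : Set X} (hs : IsOpen s) (hs_ne : s.Nonempty) (hf : ContinuousOn f s)
    {r : Y → X} {v : Set Y} (hr : ContinuousOn r v) (hfv : MapsTo f s v) (hrf : LeftInvOn r f s) :
    ∃ e : OpenPartialHomeomorph (f '' s) X, e.source = univ ∧ e.target = s ∧
      ∀ x ∈ s, (e.symm x : Y) = f x := by
  classical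
  obtain ⟨b, hb⟩ := hs_ne
  let g : X → f '' s := fun x => if hx : x ∈ s then ⟨f x, mem_image_of_mem f hx⟩
    else ⟨f b, mem_image_of_mem f hb⟩
  have hg : ∀ x ∈ s, (g x : Y) = f x := fun x hx => by simp [g, hx]
  have hr_mem : ∀ q : f '' s, r q ∈ s ∧ f (r q) = q := by
    rintro ⟨_, x, hx, rfl⟩
    simp [hrf hx, hx]
  exact ⟨{
    toFun q := r q
    invFun := g
    source := univ
    target := s
    map_source' q _ := (hr_mem q).1
    map_target' _ _ := mem_univ _
    left_inv' q _ := Subtype.ext (by rw [hg _ (hr_mem q).1, (hr_mem q).2])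
    right_inv' x hx := by simp only [hg x hx, hrf hx]
    open_source := isOpen_univ
    open_target := hs
    continuousOn_toFun := (hr.comp_continuous continuous_subtype_val (by
      rintro ⟨_, x, hx, rfl⟩
      exact hfv hx)).continuousOn
    continuousOn_invFun := by
      rw [Topology.IsInducing.subtypeVal.continuousOn_iff]
      exact hf.congr hg }, rfl, rfl, hg⟩

section Image

variable {n : WithTop ℕ∞} {𝕜 : Type*} [NontriviallyNormedField 𝕜]
  {E : Type*} [NormedAddCommGroup E] [NormedSpace 𝕜 E]
  {H : Type*} [TopologicalSpace H] {I : ModelWithCorners 𝕜 E H}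
  {P : Type*} [TopologicalSpace P] [ChartedSpace H P]
  {E' : Type*} [NormedAddCommGroup E'] [NormedSpace 𝕜 E']
  {H' : Type*} [TopologicalSpace H'] {J : ModelWithCorners 𝕜 E' H'}
  {N : Type*} [TopologicalSpace N] [ChartedSpace H' N]
  {f : P → N} {x : P}

theorem exists_isSmoothEmbedding_subtypeVal_of_isImmersionAt (hf : IsImmersionAt I J n f x)
    {K : Set N} {e : OpenPartialHomeomorph K P} (he_source : e.source = univ)
    (he_target : e.target ⊆ hf.domChart.source) (hef : ∀ y ∈ e.target, (e.symm y : N) = f y) :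
    ∃ (_ : ChartedSpace H K) (_ : IsManifold I n K),
      IsSmoothEmbedding I J n (Subtype.val : K → N) ∧ ContMDiffOn I I n e.symm e.target := by
  let φ := hf.domChart
  have hφ : φ ∈ IsManifold.maximalAtlas I n P := hf.domChart_mem_maximalAtlas
  let χ : OpenPartialHomeomorph K H := e.trans φ
  have he_mem : ∀ q, e q ∈ e.target := fun q => e.map_source (by simp [he_source])
  have hχ : χ.source = univ := by
    simpa [χ, he_source, eq_univ_iff_forall] using fun q hq => he_target (he_mem ⟨q, hq⟩)
  let _ : ChartedSpace H K := χ.singletonChartedSpace hχ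
  have : IsManifold I n K := χ.isManifold_singleton hχ
  have hfe : ∀ q, f (e q) = q := fun q => by
    rw [← hef _ (he_mem q), e.left_inv (by simp [he_source])]
  refine ⟨inferInstance, inferInstance, ⟨IsImmersionOfComplement.isImmersion
    (F := hf.complement) fun q => ?_, Topology.IsEmbedding.subtypeVal⟩, ?_⟩
  · have hK : ∀ q : K, (q : N) ∈ hf.codChart.source := fun q =>
      hfe q ▸ hf.source_subset_preimage_source (he_target (he_mem q))
    refine IsImmersionAtOfComplement.mk_of_charts hf.equiv χ hf.codChart (by simp [hχ]) (hK q)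
      (IsManifold.chart_mem_maximalAtlas q) hf.codChart_mem_maximalAtlas (fun q _ => hK q) ?_
    intro z hz
    obtain ⟨hzI, hzφ, hze⟩ : z ∈ range I ∧ I.symm z ∈ φ.target ∧ φ.symm (I.symm z) ∈ e.target := by
      simpa [χ] using hz
    have hz' : z ∈ (hf.domChart.extend I).target := by
      rw [OpenPartialHomeomorph.extend_target]
      exact ⟨hzφ, hzI⟩
    simpa [χ, φ, hef _ hze] using hf.writtenInCharts hz'
  · have hχ_symm : ContMDiffOn I I n χ.symm χ.target :=
      contMDiffOn_symm_of_mem_maximalAtlas (IsManifold.subset_maximalAtlas rfl)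
    refine (hχ_symm.comp (contMDiffOn_of_mem_maximalAtlas hφ |>.mono he_target) ?_).congr ?_
    · intro y hy
      simp [χ, φ.map_source (he_target hy), φ.left_inv (he_target hy), hy]
    · intro y hy
      simp [χ, φ.left_inv (he_target hy)]

theorem exists_isSmoothEmbedding_image_of_isImmersionAt (hn : n ≠ 0) (hf : IsImmersionAt I J n f x)
    {s : Set P} (hs : s ∈ 𝓝 x) :
    ∃ o ⊆ s, x ∈ o ∧ ∃ (_ : ChartedSpace H (f '' o)) (_ : IsManifold I n (f '' o)),
      IsSmoothEmbedding I J n (Subtype.val : f '' o → N) ∧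
      ∀ y (hy : y ∈ o), (mfderiv I J f y).range ≤
        (mfderiv I J Subtype.val (⟨f y, mem_image_of_mem f hy⟩ : f '' o)).range := by
  let φ := hf.domChart
  let o := φ.source ∩ interior s
  have ho : IsOpen o := φ.open_source.inter isOpen_interior
  have hxo : x ∈ o := ⟨hf.mem_domChart_source, mem_interior_iff_mem_nhds.2 hs⟩
  obtain ⟨ρ, hρ, hρf⟩ := exists_contMDiffOn_comp_eqOn_extend_domChart hf
  have hρφ : ∀ y ∈ o, I.symm (ρ (f y)) = φ y := by
    intro y hy
    rw [← Function.comp_apply (f := ρ), hρf hy.1, φ.extend_coe, Function.comp_apply, I.left_inv]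
  obtain ⟨e, he_source, he_target, hef⟩ := exists_openPartialHomeomorph_image ho ⟨x, hxo⟩
    (hf.continuousOn.mono inter_subset_left)
    (φ.continuousOn_symm.comp (s := hf.codChart.source ∩ (I.symm ∘ ρ) ⁻¹' φ.target)
      (I.continuous_symm.comp_continuousOn (hρ.continuousOn.mono inter_subset_left))
      fun q hq => hq.2)
    (fun y hy => ⟨hf.source_subset_preimage_source hy.1, by
      simpa [hρφ y hy] using φ.map_source hy.1⟩)
    (fun y hy => by simp [hρφ y hy, φ.left_inv hy.1])
  obtain ⟨hK, hK', h_val, he_symm⟩ := exists_isSmoothEmbedding_subtypeVal_of_isImmersionAt hf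
    he_source (he_target.subset.trans inter_subset_left) (by rwa [he_target])
  refine ⟨o, inter_subset_right.trans interior_subset, hxo, hK, hK', h_val, fun y hy => ?_⟩
  rw [he_target] at he_symm
  have hey : e.symm y = ⟨f y, mem_image_of_mem f hy⟩ := Subtype.ext (hef y hy)
  have h_comp : HasMFDerivAt I J (Subtype.val ∘ e.symm) y _ :=
    (h_val.contMDiff.contMDiffAt.mdifferentiableAt hn).hasMFDerivAt.comp y
      ((he_symm.contMDiffAt (ho.mem_nhds hy)).mdifferentiableAt hn).hasMFDerivAt
  have hf_comp : f =ᶠ[𝓝 y] Subtype.val ∘ e.symm := by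
    filter_upwards [ho.mem_nhds hy] with z hz using (hef z hz).symm
  rw [(h_comp.congr_of_eventuallyEq hf_comp).mfderiv, ← hey]
  exact LinearMap.range_comp_le_range _ _

end Image

theorem exists_isSmoothEmbedding_isTangentField_of_isImmersionAt
    {E : Type*} [NormedAddCommGroup E] [NormedSpace ℝ E]
    {H : Type*} [TopologicalSpace H] {I : ModelWithCorners ℝ E H} [I.Boundaryless]
    {P : Type*} [TopologicalSpace P] [ChartedSpace H P]
    {E' : Type*} [NormedAddCommGroup E'] [NormedSpace ℝ E']
    {H' : Type*} [TopologicalSpace H'] {J : ModelWithCorners ℝ E' H'}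
    {N : Type*} [TopologicalSpace N] [ChartedSpace H' N] [IsManifold J ∞ N]
    {f : P → N} {x : P} (hf : IsImmersionAt I J ∞ f x) {s : Set P} (hs : s ∈ 𝓝 x) :
    ∃ K : Set N, f x ∈ K ∧ ∃ (_ : ChartedSpace H K) (_ : IsManifold I ∞ K),
      IsSmoothEmbedding I J ∞ (Subtype.val : K → N) ∧
      ∀ X : (p : N) → TangentSpace J p, IsVectorField J X →
        (∀ y ∈ s, X (f y) ∈ (mfderiv I J f y).range) →
        IsTangentField J I (Subtype.val : K → N) X := by
  obtain ⟨o, ho, hxo, hK, hK', h_val, h_range⟩ :=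
    exists_isSmoothEmbedding_image_of_isImmersionAt (by simp) hf hs
  refine ⟨f '' o, mem_image_of_mem f hxo, hK, hK', h_val, fun X hX hXf =>
    isTangentField_of_mem_range_mfderiv h_val.isImmersion.isImmersionAt hX ?_⟩
  rintro ⟨_, y, hy, rfl⟩
  exact h_range y hy (hXf y (ho hy))

theorem contDiffOn_infty_of_hasDerivAt {𝕜 : Type*} [NontriviallyNormedField 𝕜]
    {E : Type*} [NormedAddCommGroup E] [NormedSpace 𝕜 E] {γ : 𝕜 → E} {v : E → E} {s : Set 𝕜}
    {t : Set E} (hs : IsOpen s) (hv : ContDiffOn 𝕜 ∞ v t) (hγ : MapsTo γ s t)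
    (hγv : ∀ x ∈ s, HasDerivAt γ (v (γ x)) x) : ContDiffOn 𝕜 ∞ γ s := by
  rw [contDiffOn_infty]
  intro k
  induction k with
  | zero => exact contDiffOn_zero.2 fun x hx => (hγv x hx).continuousAt.continuousWithinAt
  | succ k ih =>
    push_cast
    rw [contDiffOn_succ_iff_deriv_of_isOpen hs]
    exact ⟨fun x hx => (hγv x hx).differentiableAt.differentiableWithinAt, by simp,
      ((hv.of_le (mod_cast le_top)).comp ih hγ).congr fun x hx => (hγv x hx).deriv⟩

section IntegralCurve

variable {E : Type*} [NormedAddCommGroup E] [NormedSpace ℝ E]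
  {H : Type*} [TopologicalSpace H] {I : ModelWithCorners ℝ E H}
  {N : Type*} [TopologicalSpace N] [ChartedSpace H N] [IsManifold I ∞ N]
  {X : (p : N) → TangentSpace I p}

theorem contDiffOn_tangentCoordChange_comp_extChartAt_symm (hX : IsVectorField I X) (p : N) :
    ContDiffOn ℝ ∞ ((fun q => tangentCoordChange I q p q (X q)) ∘ (extChartAt I p).symm)
      (extChartAt I p).target := by
  have h_source : ContMDiffOn I 𝓘(ℝ, E) ∞ (fun q => tangentCoordChange I q p q (X q))
      (extChartAt I p).source := by
    have h_iff := (trivializationAt E (TangentSpace I) p).contMDiffOn_section_baseSet_iff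
      (IB := I) (n := ∞) (s := X)
    rw [TangentBundle.trivializationAt_baseSet, ← extChartAt_source I] at h_iff
    exact h_iff.1 hX.contMDiffOn
  exact (h_source.comp (contMDiffOn_extChartAt_symm p)
    (extChartAt I p).mapsTo_symm).contDiffOn

theorem contMDiffAt_of_isMIntegralCurveAt (hX : IsVectorField I X) {γ : ℝ → N} {t : ℝ}
    (hγ : IsMIntegralCurveAt γ X t) : ContMDiffAt 𝓘(ℝ, ℝ) I ∞ γ t := by
  have : IsManifold I 1 N := IsManifold.of_le (n := ∞) (by simp)
  let φ := extChartAt I (γ t)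
  let v : N → E := fun q => tangentCoordChange I q (γ t) q (X q)
  have h_source : ∀ᶠ s in 𝓝 t, γ s ∈ φ.source :=
    hγ.continuousAt.preimage_mem_nhds (extChartAt_source_mem_nhds _)
  obtain ⟨o, ho, ho_open, hto⟩ := mem_nhds_iff.1 (hγ.eventually_hasDerivAt.and h_source)
  have hφγ : ContDiffOn ℝ ∞ (φ ∘ γ) o := by
    refine contDiffOn_infty_of_hasDerivAt ho_open
      (contDiffOn_tangentCoordChange_comp_extChartAt_symm hX (γ t))
      (fun s hs => φ.map_source (ho hs).2) fun s hs => ?_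
    have h_left : φ.symm (φ (γ s)) = γ s := φ.left_inv (ho hs).2
    change HasDerivAt (φ ∘ γ) (v (φ.symm (φ (γ s)))) s
    rw [h_left]
    exact (ho hs).1
  have hγ_smooth : ContMDiffOn 𝓘(ℝ, ℝ) I ∞ γ o :=
    ((contMDiffOn_extChartAt_symm (γ t)).comp hφγ.contMDiffOn
      fun s hs => φ.map_source (ho hs).2).congr fun s hs => (φ.left_inv (ho hs).2).symm
  exact hγ_smooth.contMDiffAt (ho_open.mem_nhds hto)

end IntegralCurve

/-- The surface swept out by the curve `γ` under the flow `θ`: the first coordinate is the time of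
the flow, the second one is the parameter of the curve. -/
abbrev sweep {N : Type*} (θ : ℝ → N → N) (γ : ℝ → N) (x : EuclideanSpace ℝ (Fin 2)) : N :=
  θ (x 0) (γ (x 1))

section Sweep

variable {E : Type*} [NormedAddCommGroup E] [NormedSpace ℝ E]
  {H : Type*} [TopologicalSpace H] {I : ModelWithCorners ℝ E H}
  {N : Type*} [TopologicalSpace N] [ChartedSpace H N]
  {θ : ℝ → N → N} {γ : ℝ → N} {V W : (p : N) → TangentSpace I p} {x : EuclideanSpace ℝ (Fin 2)}

theorem contMDiffAt_sweep {n : WithTop ℕ∞}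
    (hθ : ContMDiff (𝓘(ℝ, ℝ).prod I) I n fun y : ℝ × N => θ y.1 y.2)
    (hγ : ContMDiffAt 𝓘(ℝ, ℝ) I n γ (x 1)) : ContMDiffAt (𝓡 2) I n (sweep θ γ) x := by
  have h_coord (i : Fin 2) :
      ContMDiffAt (𝓡 2) 𝓘(ℝ, ℝ) n (fun y : EuclideanSpace ℝ (Fin 2) => y i) x :=
    (EuclideanSpace.proj i : EuclideanSpace ℝ (Fin 2) →L[ℝ] ℝ).contDiff.contMDiff.contMDiffAt
  exact hθ.contMDiffAt.comp x ((h_coord 0).prodMk (hγ.comp x (h_coord 1)))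

theorem mfderiv_sweep
    (hθ : MDifferentiableAt (𝓘(ℝ, ℝ).prod I) I (fun y : ℝ × N => θ y.1 y.2) (x 0, γ (x 1)))
    (hV : IsMIntegralCurveAt (θ · (γ (x 1))) V (x 0)) (hW : IsMIntegralCurveAt γ W (x 1))
    (w : EuclideanSpace ℝ (Fin 2)) :
    mfderiv (𝓡 2) I (sweep θ γ) x w =
      w 0 • V (sweep θ γ x) + w 1 • mfderiv I I (θ (x 0)) (γ (x 1)) (W (γ (x 1))) := by
  have h_coord (i : Fin 2) : HasMFDerivAt (𝓡 2) 𝓘(ℝ, ℝ) (fun y : EuclideanSpace ℝ (Fin 2) => y i) x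
      (EuclideanSpace.proj i : EuclideanSpace ℝ (Fin 2) →L[ℝ] ℝ) :=
    (EuclideanSpace.proj i : EuclideanSpace ℝ (Fin 2) →L[ℝ] ℝ).hasFDerivAt.hasMFDerivAt
  have h_sweep : HasMFDerivAt (𝓡 2) I (sweep θ γ) x _ :=
    hθ.hasMFDerivAt.comp (f := fun y : EuclideanSpace ℝ (Fin 2) => (y 0, γ (y 1))) x
      ((h_coord 0).prodMk (hW.hasMFDerivAt.comp (f := fun y : EuclideanSpace ℝ (Fin 2) => y 1) x
        (h_coord 1)))
  rw [h_sweep.mfderiv]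
  refine (mfderiv_prod_eq_add_apply hθ).trans (congrArg₂ (· + ·) ?_ ?_)
  · exact DFunLike.congr_fun hV.hasMFDerivAt.mfderiv (w 0)
  · exact map_smul (mfderiv I I (θ (x 0)) (γ (x 1))) (w 1) (W (γ (x 1)))

theorem span_pair_le_range_mfderiv_sweep
    (hθ : MDifferentiableAt (𝓘(ℝ, ℝ).prod I) I (fun y : ℝ × N => θ y.1 y.2) (x 0, γ (x 1)))
    (hV : IsMIntegralCurveAt (θ · (γ (x 1))) V (x 0)) (hW : IsMIntegralCurveAt γ W (x 1))
    {c : ℝ} (hc : c ≠ 0)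
    (hθW : mfderiv I I (θ (x 0)) (γ (x 1)) (W (γ (x 1))) = c • W (sweep θ γ x)) :
    Submodule.span ℝ {V (sweep θ γ x), W (sweep θ γ x)} ≤
      (mfderiv (𝓡 2) I (sweep θ γ) x).range := by
  rw [Submodule.span_le, insert_subset_iff, singleton_subset_iff]
  exact ⟨⟨!₂[1, 0], by simp [mfderiv_sweep hθ hV hW]⟩,
    ⟨!₂[0, c⁻¹], by simp [mfderiv_sweep hθ hV hW, hθW, hc]⟩⟩

theorem injective_mfderiv_sweep
    (hθ : MDifferentiableAt (𝓘(ℝ, ℝ).prod I) I (fun y : ℝ × N => θ y.1 y.2) (x 0, γ (x 1)))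
    (hV : IsMIntegralCurveAt (θ · (γ (x 1))) V (x 0)) (hW : IsMIntegralCurveAt γ W (x 1))
    {c : ℝ} (hc : c ≠ 0)
    (hθW : mfderiv I I (θ (x 0)) (γ (x 1)) (W (γ (x 1))) = c • W (sweep θ γ x))
    (hVW : LinearIndependent ℝ ![V (sweep θ γ x), W (sweep θ γ x)]) :
    Function.Injective (mfderiv (𝓡 2) I (sweep θ γ) x) := by
  refine (injective_iff_map_eq_zero _).2 fun (w : EuclideanSpace ℝ (Fin 2)) hw => ?_
  rw [mfderiv_sweep hθ hV hW, hθW, smul_smul] at hw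
  obtain ⟨hw₀, hw₁⟩ := LinearIndependent.pair_iff.1 hVW _ _ hw
  refine PiLp.ext fun i => ?_
  fin_cases i
  · exact hw₀
  · exact (mul_eq_zero.1 hw₁).resolve_right hc

end Sweep

theorem hasLeftInverse_of_injective {𝕜 : Type*} [RCLike 𝕜] {E : Type*} [NormedAddCommGroup E]
    [NormedSpace 𝕜 E] [FiniteDimensional 𝕜 E] {F : Type*} [NormedAddCommGroup F] [NormedSpace 𝕜 F]
    [CompleteSpace F] {L : E →L[𝕜] F} (hL : Function.Injective L) : L.HasLeftInverse := by
  have : CompleteSpace E := FiniteDimensional.complete 𝕜 E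
  exact .of_injective_of_isClosed_range_of_closedComplement_range hL
    (Submodule.closed_of_finiteDimensional L.range) (.of_finiteDimensional L.range)

theorem exists_integralSurface {E : Type*} [NormedAddCommGroup E] [NormedSpace ℝ E]
    [CompleteSpace E] {N : Type*} [TopologicalSpace N] [ChartedSpace E N]
    [IsManifold 𝓘(ℝ, E) ∞ N] {V W : (p : N) → TangentSpace 𝓘(ℝ, E) p} {θ : ℝ → N → N}
    (hθ : ContMDiff (𝓘(ℝ, ℝ).prod 𝓘(ℝ, E)) 𝓘(ℝ, E) ∞ fun y : ℝ × N => θ y.1 y.2)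
    (hθ₀ : ∀ p, θ 0 p = p) (hV : ∀ p, IsMIntegralCurve (θ · p) V)
    (hW : IsVectorField 𝓘(ℝ, E) W) {c : ℝ → N → ℝ} (hc : ∀ t p, c t p ≠ 0)
    (hθW : ∀ t p, mfderiv 𝓘(ℝ, E) 𝓘(ℝ, E) (θ t) p (W p) = c t p • W (θ t p))
    {p : N} (hp : LinearIndependent ℝ ![V p, W p]) :
    ∃ K : Set N, p ∈ K ∧
      ∃ (_ : ChartedSpace (EuclideanSpace ℝ (Fin 2)) K) (_ : IsManifold (𝓡 2) ∞ K),
        IsSmoothEmbedding (𝓡 2) 𝓘(ℝ, E) ∞ (Subtype.val : K → N) ∧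
        ∀ X : (q : N) → TangentSpace 𝓘(ℝ, E) q, IsVectorField 𝓘(ℝ, E) X →
          (∀ q, X q ∈ Submodule.span ℝ {V q, W q}) →
          IsTangentField 𝓘(ℝ, E) (𝓡 2) (Subtype.val : K → N) X := by
  have : IsManifold 𝓘(ℝ, E) 1 N := IsManifold.of_le (n := ∞) (by simp)
  obtain ⟨γ, hγp, hγ⟩ := exists_isMIntegralCurveAt_of_contMDiffAt_boundaryless 0
    ((ContMDiff.of_le hW (by simp)).contMDiffAt (x := p))
  obtain ⟨J, hJ, hJ_open, h0J⟩ := mem_nhds_iff.1 hγ.eventually_nhds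
  let s : Set (EuclideanSpace ℝ (Fin 2)) := {x | x 1 ∈ J}
  have hs : IsOpen s := hJ_open.preimage (by fun_prop)
  have h0s : (0 : EuclideanSpace ℝ (Fin 2)) ∈ s := h0J
  have hγW : ∀ x ∈ s, IsMIntegralCurveAt γ W (x 1) := fun x hx => hJ hx
  have hθd (y : ℝ × N) := hθ.contMDiffAt.mdifferentiableAt (x := y) (by simp)
  have hVat (q : N) (t : ℝ) := (hV q).isMIntegralCurveAt t
  have h_sweep_zero : sweep θ γ 0 = p := (hθ₀ _).trans hγp
  have h_smooth : ContMDiffOn (𝓡 2) 𝓘(ℝ, E) ∞ (sweep θ γ) s := fun x hx =>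
    (contMDiffAt_sweep hθ (contMDiffAt_of_isMIntegralCurveAt hW (hγW x hx))).contMDiffWithinAt
  have h_inj : Function.Injective (mfderiv (𝓡 2) 𝓘(ℝ, E) (sweep θ γ) 0) :=
    injective_mfderiv_sweep (hθd _) (hVat _ _) (hγW 0 h0s) (hc _ _) (hθW _ _)
      (h_sweep_zero.symm ▸ hp)
  have h_immersion : IsImmersionAt (𝓡 2) 𝓘(ℝ, E) ∞ (sweep θ γ) 0 :=
    isImmersionAt_of_hasLeftInverse_mfderiv hs h_smooth (by simp) h0s
      (hasLeftInverse_of_injective (E := EuclideanSpace ℝ (Fin 2)) (F := E) h_inj)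
  obtain ⟨K, hpK, hK, hK', h_val, hK_tangent⟩ :=
    exists_isSmoothEmbedding_isTangentField_of_isImmersionAt h_immersion (hs.mem_nhds h0s)
  exact ⟨K, h_sweep_zero ▸ hpK, hK, hK', h_val, fun X hX hXVW => hK_tangent X hX fun x hx =>
    span_pair_le_range_mfderiv_sweep (hθd _) (hVat _ _) (hγW x hx) (hc _ _) (hθW _ _) (hXVW _)⟩

section ExteriorPower

variable {𝕜 : Type*} [Field 𝕜] {V : Type*} [AddCommGroup V] [Module 𝕜 V] {k : ℕ}

theorem ιMulti_ne_zero_of_linearIndependent {v : Fin k → V} (hv : LinearIndependent 𝕜 v) :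
    exteriorPower.ιMulti 𝕜 k v ≠ 0 := by
  let s : powersetCard (Fin k) k := powersetCard.ofFinEmbEquiv (OrderIso.refl _).toOrderEmbedding
  have h_family := (exteriorPower.ιMulti_family_linearIndependent_field (n := k) hv).ne_zero s
  rwa [exteriorPower.ιMulti_family, Equiv.symm_apply_apply] at h_family

theorem mem_span_range_of_ιMulti_eq {v w : Fin k → V} (hv : LinearIndependent 𝕜 v)
    (hvw : exteriorPower.ιMulti 𝕜 k v = exteriorPower.ιMulti 𝕜 k w) (i : Fin k) :
    w i ∈ Submodule.span 𝕜 (range v) := by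
  -- Otherwise `w i ∧ v ≠ 0`, whereas `w i ∧ v = w i ∧ w` has a repeated factor.
  by_contra hi
  have h_cons (z : Fin k → V) :
      (exteriorPower.ιMulti 𝕜 (k + 1) (Fin.cons (w i) z) : ExteriorAlgebra 𝕜 V) =
        ExteriorAlgebra.ι 𝕜 (w i) * exteriorPower.ιMulti 𝕜 k z := by
    simp [exteriorPower.ιMulti_apply_coe, ExteriorAlgebra.ιMulti_succ_apply, Matrix.vecTail]
  refine ιMulti_ne_zero_of_linearIndependent (linearIndependent_finCons.2 ⟨hv, hi⟩)
    (Subtype.ext ?_)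
  rw [h_cons, hvw, ← h_cons,
    (exteriorPower.ιMulti 𝕜 (k + 1)).map_eq_zero_of_eq _ (by simp) (Fin.succ_ne_zero i).symm]

end ExteriorPower

section Differential

variable {E : Type*} [NormedAddCommGroup E] [NormedSpace ℝ E]
  {H : Type*} [TopologicalSpace H] {I : ModelWithCorners ℝ E H}
  {N : Type*} [TopologicalSpace N] [ChartedSpace H N] {F : N → ℝ}

theorem differential_comp {E' : Type*} [NormedAddCommGroup E'] [NormedSpace ℝ E']
    {H' : Type*} [TopologicalSpace H'] {J : ModelWithCorners ℝ E' H'}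
    {P : Type*} [TopologicalSpace P] [ChartedSpace H' P] {f : P → N} {p : P}
    (hF : MDifferentiableAt I 𝓘(ℝ, ℝ) F (f p)) (hf : MDifferentiableAt J I f p)
    (a : TangentSpace J p) :
    differential J (F ∘ f) p a = differential I F (f p) (mfderiv J I f p a) :=
  DFunLike.congr_fun (mfderiv_comp p hF hf) a

theorem hasDerivAt_comp_of_isMIntegralCurveAt {X : (p : N) → TangentSpace I p} {γ : ℝ → N} {t : ℝ}
    (hγ : IsMIntegralCurveAt γ X t) (hF : MDifferentiableAt I 𝓘(ℝ, ℝ) F (γ t)) :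
    HasDerivAt (F ∘ γ) (act I X F (γ t)) t := by
  have h_comp : HasFDerivAt (F ∘ γ) _ t := (hF.hasMFDerivAt.comp t hγ.hasMFDerivAt).hasFDerivAt
  rw [hasDerivAt_iff_hasFDerivAt]
  refine h_comp.congr_fderiv (ContinuousLinearMap.ext fun s : ℝ => ?_)
  exact map_smul (mfderiv I 𝓘(ℝ, ℝ) F (γ t)) s (X (γ t))

variable [IsManifold I 1 N]

theorem differential_eq_of_eventuallyEq_comp_extChartAt {p q : N} {l : E →L[ℝ] ℝ}
    (hF : F =ᶠ[𝓝 q] fun q => l (extChartAt I p q)) (hq : q ∈ (chartAt H p).source)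
    (a : TangentSpace I q) : differential I F q a = l (tangentCoordChange I q p q a) := by
  have h_chart := hasMFDerivAt_extChartAt (I := I) hq
  rw [mfderiv_chartAt_eq_tangentCoordChange hq] at h_chart
  exact DFunLike.congr_fun
    ((l.hasFDerivAt.hasMFDerivAt.comp q h_chart).congr_of_eventuallyEq hF).mfderiv a

theorem differential_eq_of_eventuallyEq_comp_extChartAt_self {p : N} {l : E →L[ℝ] ℝ}
    (hF : F =ᶠ[𝓝 p] fun q => l (extChartAt I p q)) (a : TangentSpace I p) :
    differential I F p a = l a :=
  (differential_eq_of_eventuallyEq_comp_extChartAt hF (mem_chart_source H p) a).trans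
    (congrArg l (tangentCoordChange_self (mem_extChartAt_source p)))

end Differential

section TangentBundle

variable {E : Type*} [NormedAddCommGroup E] [NormedSpace ℝ E]
  {H : Type*} [TopologicalSpace H] {I : ModelWithCorners ℝ E H}
  {M : Type*} [TopologicalSpace M] [ChartedSpace H M] [IsManifold I ∞ M] {h : M → ℝ}

theorem IsScalarField.contMDiff_scalarLift (hh : IsScalarField I h) :
    ContMDiff I.tangent 𝓘(ℝ, ℝ) ∞ (scalarLift I h) :=
  (contMDiff_snd_tangentBundle_modelSpace ℝ 𝓘(ℝ, ℝ)).comp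
    (hh.contMDiff_tangentMap (m := ∞) (by simp))

theorem IsScalarField.contMDiff_comp_proj (hh : IsScalarField I h) :
    ContMDiff I.tangent 𝓘(ℝ, ℝ) ∞ fun u : TangentBundle I M => h u.proj :=
  ContMDiff.comp hh (Bundle.contMDiff_proj (TangentSpace I))

theorem differential_comp_proj_eq_of_eventuallyEq {u : TangentBundle I M} {l : E →L[ℝ] ℝ}
    (hh : h =ᶠ[𝓝 u.proj] fun q => l (extChartAt I u.proj q)) (a : E × E) :
    differential I.tangent (fun v : TangentBundle I M => h v.proj) u a = l a.1 := by
  have : IsManifold I.tangent 1 (TangentBundle I M) := IsManifold.of_le (n := ∞) (by simp)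
  have h_proj : Filter.Tendsto (Bundle.TotalSpace.proj : TangentBundle I M → M) (𝓝 u) (𝓝 u.proj) :=
    (FiberBundle.continuous_proj _ _).continuousAt
  refine differential_eq_of_eventuallyEq_comp_extChartAt_self
    (l := l.comp (ContinuousLinearMap.fst ℝ E E)) ?_ a
  exact h_proj.eventually hh

theorem differential_scalarLift_eq_of_eventuallyEq {u : TangentBundle I M} {l : E →L[ℝ] ℝ}
    (hh : h =ᶠ[𝓝 u.proj] fun q => l (extChartAt I u.proj q)) (a : E × E) :
    differential I.tangent (scalarLift I h) u a = l a.2 := by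
  have : IsManifold I.tangent 1 (TangentBundle I M) := IsManifold.of_le (n := ∞) (by simp)
  have : IsManifold I 1 M := IsManifold.of_le (n := ∞) (by simp)
  have h_proj : Filter.Tendsto (Bundle.TotalSpace.proj : TangentBundle I M → M) (𝓝 u) (𝓝 u.proj) :=
    (FiberBundle.continuous_proj _ _).continuousAt
  refine differential_eq_of_eventuallyEq_comp_extChartAt_self
    (l := l.comp (ContinuousLinearMap.snd ℝ E E)) ?_ a
  filter_upwards [h_proj.eventually hh.eventuallyEq_nhds,
    h_proj.eventually (chart_source_mem_nhds H u.proj)] with v hv hv_source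
  exact differential_eq_of_eventuallyEq_comp_extChartAt hv hv_source v.snd

variable [FiniteDimensional ℝ E] [T2Space M]

theorem exists_isScalarField_eventuallyEq_comp_extChartAt (p : M) (l : E →L[ℝ] ℝ) :
    ∃ h : M → ℝ, IsScalarField I h ∧ h =ᶠ[𝓝 p] fun q => l (extChartAt I p q) := by
  obtain ⟨χ⟩ : Nonempty (SmoothBumpFunction I p) := inferInstance
  refine ⟨fun q => χ q • l (extChartAt I p q), χ.contMDiff_smul ?_, ?_⟩
  · exact l.contDiff.contMDiff.comp_contMDiffOn contMDiffOn_extChartAt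
  · filter_upwards [χ.eventuallyEq_one] with q hq
    simp [hq]

theorem exists_isScalarField_scalarLift_eq_one {u : TangentBundle I M} (hu : u.snd ≠ 0) :
    ∃ h : M → ℝ, IsScalarField I h ∧ scalarLift I h u = 1 := by
  have : IsManifold I 1 M := IsManifold.of_le (n := ∞) (by simp)
  obtain ⟨l, hl⟩ : ∃ l : E →L[ℝ] ℝ, l u.snd = 1 :=
    SeparatingDual.exists_eq_one (R := ℝ) (V := E) (x := u.snd) hu
  obtain ⟨h, hh, hhl⟩ := exists_isScalarField_eventuallyEq_comp_extChartAt (I := I) u.proj l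
  exact ⟨h, hh, (differential_eq_of_eventuallyEq_comp_extChartAt_self hhl u.snd).trans hl⟩

theorem eq_of_forall_differential_eq {u : TangentBundle I M} {a b : TangentSpace I.tangent u}
    (h_proj : ∀ h : M → ℝ, IsScalarField I h →
      differential I.tangent (fun v : TangentBundle I M => h v.proj) u a =
        differential I.tangent (fun v : TangentBundle I M => h v.proj) u b)
    (h_lift : ∀ h : M → ℝ, IsScalarField I h →
      differential I.tangent (scalarLift I h) u a = differential I.tangent (scalarLift I h) u b) :
    a = b := by
  refine Prod.ext ?_ ?_ <;> refine (SeparatingDual.eq_iff_forall_dual_eq (R := ℝ)).2 fun l => ?_ <;>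
    obtain ⟨h, hh, hhl⟩ := exists_isScalarField_eventuallyEq_comp_extChartAt (I := I) u.proj l
  · exact (differential_comp_proj_eq_of_eventuallyEq hhl a).symm.trans
      ((h_proj h hh).trans (differential_comp_proj_eq_of_eventuallyEq hhl b))
  · exact (differential_scalarLift_eq_of_eventuallyEq hhl a).symm.trans
      ((h_lift h hh).trans (differential_scalarLift_eq_of_eventuallyEq hhl b))

end TangentBundle

section Conic

variable {n : ℕ} {M : Type*} [TopologicalSpace M] [ChartedSpace (EuclideanSpace ℝ (Fin n)) M]
  {U : Set (TangentBundle (𝓡 n) M)}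

theorem scalarLift_dilate (h : M → ℝ) (c : ℝ) (u : TangentBundle (𝓡 n) M) :
    scalarLift (𝓡 n) h (dilate c u) = c * scalarLift (𝓡 n) h u :=
  map_smul (differential (𝓡 n) h u.proj) c u.snd

/-- The flow `(t, u) ↦ e ^ t u` of the radial field. -/
noncomputable def IsConic.scale (hU : IsConic U) (t : ℝ) (u : U) : U :=
  hU.dilate (Real.exp t) (Real.exp_ne_zero t) u

namespace IsConic

theorem scale_add (hU : IsConic U) (s t : ℝ) (u : U) :
    hU.scale (s + t) u = hU.scale s (hU.scale t u) := by
  refine Subtype.ext ?_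
  change (⟨_, _⟩ : TangentBundle (𝓡 n) M) = ⟨_, _⟩
  congr 1
  rw [Real.exp_add]
  exact mul_smul (Real.exp s) (Real.exp t) (u : TangentBundle (𝓡 n) M).snd

theorem scale_zero (hU : IsConic U) (u : U) : hU.scale 0 u = u := by
  simp [scale, IsConic.dilate, Vlasov.dilate]

theorem lift_scale (hU : IsConic U) (h : M → ℝ) (t : ℝ) (u : U) :
    lift U h (hU.scale t u) = Real.exp t * lift U h u :=
  scalarLift_dilate h _ _

end IsConic

variable [IsManifold (𝓡 n) ∞ M]

theorem contMDiff_dilate : ContMDiff (𝓘(ℝ, ℝ).prod (𝓡 n).tangent) (𝓡 n).tangent ∞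
    fun x : ℝ × TangentBundle (𝓡 n) M => dilate x.1 x.2 := by
  intro x
  have h_proj : ContMDiffAt (𝓘(ℝ, ℝ).prod (𝓡 n).tangent) (𝓡 n) ∞
      (fun y : ℝ × TangentBundle (𝓡 n) M => y.2.proj) x :=
    (Bundle.contMDiff_proj (TangentSpace (𝓡 n))).contMDiffAt.comp x contMDiffAt_snd
  have h_snd := (Bundle.contMDiffAt_totalSpace.1 (contMDiffAt_snd (I := 𝓘(ℝ, ℝ))
    (J := (𝓡 n).tangent) (M := ℝ) (N := TangentBundle (𝓡 n) M) (p := x) (n := ∞))).2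
  refine Bundle.contMDiffAt_totalSpace.2 ⟨h_proj, ?_⟩
  exact (contMDiffAt_fst.smul h_snd).congr_of_eventuallyEq <| .of_forall fun y =>
    map_smul (tangentCoordChange (𝓡 n) y.2.proj x.2.proj y.2.proj) y.1 y.2.snd

variable {d : ℕ} [ChartedSpace (EuclideanSpace ℝ (Fin d)) U] [IsManifold (𝓡 d) ∞ U] {h : M → ℝ}

namespace IsConicSubbundle

theorem contMDiff_pull (hU : IsConicSubbundle (d := d) U) (hh : IsScalarField (𝓡 n) h) :
    ContMDiff (𝓡 d) 𝓘(ℝ, ℝ) ∞ (pull U h) :=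
  hh.contMDiff_comp_proj.comp hU.isSmoothEmbedding.contMDiff

theorem contMDiff_lift (hU : IsConicSubbundle (d := d) U) (hh : IsScalarField (𝓡 n) h) :
    ContMDiff (𝓡 d) 𝓘(ℝ, ℝ) ∞ (lift U h) :=
  hh.contMDiff_scalarLift.comp hU.isSmoothEmbedding.contMDiff

theorem eq_of_forall_differential_eq [T2Space M] (hU : IsConicSubbundle (d := d) U) {u : U}
    {a b : TangentSpace (𝓡 d) u}
    (h_pull : ∀ h : M → ℝ, IsScalarField (𝓡 n) h →
      differential (𝓡 d) (pull U h) u a = differential (𝓡 d) (pull U h) u b)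
    (h_lift : ∀ h : M → ℝ, IsScalarField (𝓡 n) h →
      differential (𝓡 d) (lift U h) u a = differential (𝓡 d) (lift U h) u b) : a = b := by
  have h_val : MDifferentiableAt (𝓡 d) (𝓡 n).tangent (Subtype.val : U → TangentBundle (𝓡 n) M) u :=
    hU.isSmoothEmbedding.contMDiff.contMDiffAt.mdifferentiableAt (by simp)
  refine (hasLeftInverse_mfderiv_of_isImmersionAt (by simp)
    (hU.isSmoothEmbedding.isImmersion.isImmersionAt u)).injective ?_
  refine Vlasov.eq_of_forall_differential_eq (fun h hh => ?_) fun h hh => ?_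
  · have h_proj := hh.contMDiff_comp_proj.contMDiffAt.mdifferentiableAt
      (x := (u : TangentBundle (𝓡 n) M)) (by simp)
    exact (differential_comp h_proj h_val a).symm.trans
      ((h_pull h hh).trans (differential_comp h_proj h_val b))
  · have h_scalarLift := hh.contMDiff_scalarLift.contMDiffAt.mdifferentiableAt
      (x := (u : TangentBundle (𝓡 n) M)) (by simp)
    exact (differential_comp h_scalarLift h_val a).symm.trans
      ((h_lift h hh).trans (differential_comp h_scalarLift h_val b))

theorem contMDiff_scale (hU : IsConicSubbundle (d := d) U) :
    ContMDiff (𝓘(ℝ, ℝ).prod (𝓡 d)) (𝓡 d) ∞ fun x : ℝ × U => hU.scale x.1 x.2 := by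
  have h_val : ContMDiff (𝓘(ℝ, ℝ).prod (𝓡 d)) (𝓡 n).tangent ∞
      (Subtype.val ∘ fun x : ℝ × U => hU.scale x.1 x.2) :=
    contMDiff_dilate.comp ((Real.contDiff_exp.contMDiff.comp contMDiff_fst).prodMk
      (hU.isSmoothEmbedding.contMDiff.comp contMDiff_snd))
  rw [ContMDiff.iff_comp_isImmersion hU.isSmoothEmbedding.isImmersion]
  exact ⟨hU.isSmoothEmbedding.isEmbedding.continuous_iff.2 h_val.continuous, h_val⟩

theorem isMIntegralCurve_scale (hU : IsConicSubbundle (d := d) U) (u : U) :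
    IsMIntegralCurve (hU.scale · u) (hU.radial (d := d)) := by
  intro s
  let γ : ℝ → U := fun t => hU.scale t (hU.scale s u)
  have h_zero : HasMFDerivAt 𝓘(ℝ, ℝ) (𝓡 d) γ 0
      ((1 : ℝ →L[ℝ] ℝ).smulRight (hU.radial (d := d) (hU.scale s u))) := by
    have h_smooth : ContMDiff 𝓘(ℝ, ℝ) (𝓡 d) ∞ γ :=
      hU.contMDiff_scale.comp (contMDiff_id.prodMk contMDiff_const)
    have h_deriv : mfderiv 𝓘(ℝ, ℝ) (𝓡 d) γ 0 =
        (1 : ℝ →L[ℝ] ℝ).smulRight (hU.radial (d := d) (hU.scale s u)) :=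
      ContinuousLinearMap.ext_ring (one_smul ℝ (hU.radial (d := d) (hU.scale s u))).symm
    exact h_deriv ▸ (h_smooth.contMDiffAt.mdifferentiableAt (by simp)).hasMFDerivAt
  have h_sub : HasMFDerivAt 𝓘(ℝ, ℝ) 𝓘(ℝ, ℝ) (fun t : ℝ => t - s) s (1 : ℝ →L[ℝ] ℝ) :=
    ((hasFDerivAt_id s).sub_const s).hasMFDerivAt
  rw [← sub_self s] at h_zero
  refine (HasMFDerivAt.comp (f := fun t : ℝ => t - s) s h_zero h_sub).congr_of_eventuallyEq
    (.of_forall fun t => ?_)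
  change hU.scale t u = hU.scale (t - s) (hU.scale s u)
  rw [← hU.scale_add, sub_add_cancel]

theorem act_radial_pull (hU : IsConicSubbundle (d := d) U) (hh : IsScalarField (𝓡 n) h) (u : U) :
    act (𝓡 d) hU.radial (pull U h) u = 0 := by
  have h_deriv := hasDerivAt_comp_of_isMIntegralCurveAt
    ((hU.isMIntegralCurve_scale u).isMIntegralCurveAt 0)
    ((hU.contMDiff_pull hh).contMDiffAt.mdifferentiableAt (by simp))
  rw [hU.scale_zero] at h_deriv
  exact h_deriv.unique (hasDerivAt_const 0 (pull U h u))

theorem act_radial_lift (hU : IsConicSubbundle (d := d) U) (hh : IsScalarField (𝓡 n) h) (u : U) :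
    act (𝓡 d) hU.radial (lift U h) u = lift U h u := by
  have h_deriv := hasDerivAt_comp_of_isMIntegralCurveAt
    ((hU.isMIntegralCurve_scale u).isMIntegralCurveAt 0)
    ((hU.contMDiff_lift hh).contMDiffAt.mdifferentiableAt (by simp))
  rw [hU.scale_zero] at h_deriv
  have h_exp : HasDerivAt (fun t => lift U h (hU.scale t u)) (lift U h u) 0 := by
    simpa [hU.lift_scale] using (Real.hasDerivAt_exp 0).mul_const (lift U h u)
  exact h_deriv.unique h_exp

theorem mdifferentiableAt_scale (hU : IsConicSubbundle (d := d) U) (s : ℝ) (u : U) :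
    MDifferentiableAt (𝓡 d) (𝓡 d) (hU.scale s) u :=
  (hU.contMDiff_scale.comp (contMDiff_const (c := s).prodMk
    contMDiff_id)).contMDiffAt.mdifferentiableAt (by simp)

end IsConicSubbundle

namespace IsVlasovField

variable (hU : IsConicSubbundle (d := d) U) {W : (u : U) → TangentSpace (𝓡 d) u}

theorem differential_pull_mfderiv_scale (hW : IsVlasovField hU.toIsConic W)
    (hh : IsScalarField (𝓡 n) h) (s : ℝ) (u : U) :
    differential (𝓡 d) (pull U h) (hU.scale s u) (mfderiv (𝓡 d) (𝓡 d) (hU.scale s) u (W u)) =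
      Real.exp (-s) * act (𝓡 d) W (pull U h) (hU.scale s u) := by
  calc differential (𝓡 d) (pull U h) (hU.scale s u) (mfderiv (𝓡 d) (𝓡 d) (hU.scale s) u (W u))
      = act (𝓡 d) W (pull U h) u :=
        (differential_comp ((hU.contMDiff_pull hh).contMDiffAt.mdifferentiableAt (by simp))
          (hU.mdifferentiableAt_scale s u) (W u)).symm
    _ = Real.exp (-s) * act (𝓡 d) W (pull U h) (hU.scale s u) := by
        rw [hW.horizontal h hh, hW.horizontal h hh, hU.lift_scale, ← mul_assoc, ← Real.exp_add,
          neg_add_cancel, Real.exp_zero, one_mul]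

theorem differential_lift_mfderiv_scale (hW : IsVlasovField hU.toIsConic W)
    (hh : IsScalarField (𝓡 n) h) (s : ℝ) (u : U) :
    differential (𝓡 d) (lift U h) (hU.scale s u) (mfderiv (𝓡 d) (𝓡 d) (hU.scale s) u (W u)) =
      Real.exp (-s) * act (𝓡 d) W (lift U h) (hU.scale s u) := by
  have h_lift {v : U} : MDifferentiableAt (𝓡 d) 𝓘(ℝ, ℝ) (lift U h) v :=
    (hU.contMDiff_lift hh).contMDiffAt.mdifferentiableAt (by simp)
  calc differential (𝓡 d) (lift U h) (hU.scale s u) (mfderiv (𝓡 d) (𝓡 d) (hU.scale s) u (W u))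
      = act (𝓡 d) W (lift U h ∘ hU.scale s) u :=
        (differential_comp h_lift (hU.mdifferentiableAt_scale s u) (W u)).symm
    _ = act (𝓡 d) W (fun v => Real.exp s • lift U h v) u :=
        congrArg (act (𝓡 d) W · u) (funext (hU.lift_scale h s))
    _ = Real.exp s * act (𝓡 d) W (lift U h) u :=
        DFunLike.congr_fun (h_lift.hasMFDerivAt.const_smul (Real.exp s)).mfderiv (W u)
    _ = Real.exp (-s) * (Real.exp s ^ 2 * act (𝓡 d) W (lift U h) u) := by
        rw [Real.exp_neg]
        field_simp
    _ = Real.exp (-s) * act (𝓡 d) W (lift U h) (hU.scale s u) :=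
        congrArg (Real.exp (-s) * ·) (hW.quadratic h hh u (Real.exp s) (Real.exp_pos s)).symm

variable [T2Space M]

theorem mfderiv_scale (hW : IsVlasovField hU.toIsConic W) (s : ℝ) (u : U) :
    mfderiv (𝓡 d) (𝓡 d) (hU.scale s) u (W u) = Real.exp (-s) • W (hU.scale s u) := by
  refine hU.eq_of_forall_differential_eq (fun h hh => ?_) fun h hh => ?_
  · have h_smul := map_smul (differential (𝓡 d) (pull U h) (hU.scale s u)) (Real.exp (-s))
      (W (hU.scale s u))
    exact (hW.differential_pull_mfderiv_scale hU hh s u).trans h_smul.symm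
  · have h_smul := map_smul (differential (𝓡 d) (lift U h) (hU.scale s u)) (Real.exp (-s))
      (W (hU.scale s u))
    exact (hW.differential_lift_mfderiv_scale hU hh s u).trans h_smul.symm

theorem linearIndependent_radial (hW : IsVlasovField hU.toIsConic W) (u : U) :
    LinearIndependent ℝ ![hU.radial u, W u] := by
  obtain ⟨h, hh, h_lift : lift U h u = 1⟩ :=
    exists_isScalarField_scalarLift_eq_one (hU.snd_ne_zero u u.2)
  have hW_pull : differential (𝓡 d) (pull U h) u (W u) = 1 := (hW.horizontal h hh u).trans h_lift
  have hR_pull : differential (𝓡 d) (pull U h) u (hU.radial u) = 0 := hU.act_radial_pull hh u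
  have hR_lift : differential (𝓡 d) (lift U h) u (hU.radial u) = 1 :=
    (hU.act_radial_lift hh u).trans h_lift
  refine LinearIndependent.pair_iff.2 fun a b hab => ?_
  have hb : b = 0 := by
    simpa [hR_pull, hW_pull] using congrArg (differential (𝓡 d) (pull U h) u) hab
  have ha : a = 0 := by
    simpa [hR_lift, hb] using congrArg (differential (𝓡 d) (lift U h) u) hab
  exact ⟨ha, hb⟩

end IsVlasovField

end Conic

theorem mem_span_of_isRepresentation {E : Type*} [NormedAddCommGroup E] [NormedSpace ℝ E]
    {H : Type*} [TopologicalSpace H] {I : ModelWithCorners ℝ E H}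
    {N : Type*} [TopologicalSpace N] [ChartedSpace H N] [IsManifold I ∞ N]
    {V W X Y : (p : N) → TangentSpace I p} (h : IsRepresentation I (wedge I V W) X Y) {p : N}
    (hVW : LinearIndependent ℝ ![V p, W p]) :
    X p ∈ Submodule.span ℝ {V p, W p} ∧ Y p ∈ Submodule.span ℝ {V p, W p} := by
  have h_mem := mem_span_range_of_ιMulti_eq hVW (congrFun h.2.2 p)
  rw [Matrix.range_cons, Matrix.range_cons, Matrix.range_empty, union_empty, singleton_union]
    at h_mem
  exact ⟨h_mem 0, h_mem 1⟩

end Vlasov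

theorem mainTheorem5_general {n d : ℕ} {M : Type*} [TopologicalSpace M] [T2Space M]
    [ChartedSpace (EuclideanSpace ℝ (Fin n)) M]
    [IsManifold (𝓡 n) ∞ M] (U : Set (TangentBundle (𝓡 n) M))
    [ChartedSpace (EuclideanSpace ℝ (Fin d)) U] [IsManifold (𝓡 d) ∞ U]
    (hU : Vlasov.IsConicSubbundle (d := d) U)
    (Ψ : (u : U) → ⋀[ℝ]^2 (TangentSpace (𝓡 d) u))
    (hΨ : Vlasov.IsVlasovBivector hU.toIsConic Ψ) (u : U) :
    ∃ K : Set U, u ∈ K ∧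
      ∃ (_ : ChartedSpace (EuclideanSpace ℝ (Fin 2)) K) (_ : IsManifold (𝓡 2) ∞ K),
        IsSmoothEmbedding (𝓡 2) (𝓡 d) ∞ (Subtype.val : K → U) ∧
        Vlasov.IsTangentBivector (𝓡 d) (𝓡 2) (Subtype.val : K → U) Ψ := by
  obtain ⟨h_horizontal, W, hW, rfl⟩ := hΨ
  have h_indep := hW.linearIndependent_radial hU
  obtain ⟨K, huK, hK, hK', h_val, h_tangent⟩ := Vlasov.exists_integralSurface
    hU.contMDiff_scale hU.scale_zero hU.isMIntegralCurve_scale hW.isVectorField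
    (fun t _ => (Real.exp_pos (-t)).ne') (hW.mfderiv_scale hU) (h_indep u)
  refine ⟨K, huK, hK, hK', h_val, h_horizontal.simple, fun X Y hXY => ?_⟩
  have h_span (v : U) := Vlasov.mem_span_of_isRepresentation hXY (h_indep v)
  exact ⟨h_tangent X hXY.1 fun v => (h_span v).1, h_tangent Y hXY.2.1 fun v => (h_span v).2⟩

theorem mainTheorem5 {n d : ℕ} {M : Type*} [TopologicalSpace M] [T2Space M]
    [SecondCountableTopology M] [ChartedSpace (EuclideanSpace ℝ (Fin n)) M]
    [IsManifold (𝓡 n) ∞ M] (U : Set (TangentBundle (𝓡 n) M))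
    [ChartedSpace (EuclideanSpace ℝ (Fin d)) U] [IsManifold (𝓡 d) ∞ U]
    (hU : Vlasov.IsConicSubbundle (d := d) U)
    (Ψ : (u : U) → ⋀[ℝ]^2 (TangentSpace (𝓡 d) u))
    (hΨ : Vlasov.IsVlasovBivector hU.toIsConic Ψ) (u : U) :
    ∃ K : Set U, u ∈ K ∧
      ∃ (_ : ChartedSpace (EuclideanSpace ℝ (Fin 2)) K) (_ : IsManifold (𝓡 2) ∞ K),
        IsSmoothEmbedding (𝓡 2) (𝓡 d) ∞ (Subtype.val : K → U) ∧
        Vlasov.IsTangentBivector (𝓡 d) (𝓡 2) (Subtype.val : K → U) Ψ :=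
  mainTheorem5_general U hU Ψ hΨ u
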